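/- For a finite commutative ring $R$, a pair $(a,b)\in R^2$ is called unimodular if $ad-bc=1$ for some $c,d\in R$. The Platonic graph $\mathrm{Pl}(R)$ has as vertices the unimodular pairs taken up to sign, $[a,b]=\{\pm(a,b)\}$, and $[a,b]$, $[c,d]$ are adjacent when $ad-bc=\pm 1$. For a finite graph $X$ with at least two vertices, put $$\mathrm{iso}(X)=\min \frac{e(U,W)}{\min\{|U|,|W|\}},$$ the minimum being over all partitions of the vertices into two non-empty sets $U$ and $W$, where $e(U,W)$ is the number of edges between $U$ and $W$. A non-trivial eigenvalue of a connected $d$-regular graph is an eigenvalue of its adjacency matrix other than $d$. Let $N>1$ be an odd integer, and let $p$ be the smallest prime dividing $N$. Then $\mathrm{Pl}(\mathbb{Z}/(N))$ is connected and regular of degree $N$, its largest non-trivial eigenvalue is at most $N/\sqrt{p}$, and $$\mathrm{iso}\big(\mathrm{Pl}(\mathbb{Z}/(N))\big)\ge \frac{N}{2}\Big(1-\frac{1}{\sqrt p}\Big).$$ -/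

import Mathlib

/-- The determinant `a * d - b * c` of two pairs `(a, b)` and `(c, d)`. -/
def pairDet {R : Type*} [CommRing R] (v w : R × R) : R :=
  v.1 * w.2 - v.2 * w.1

/-- The unimodular pairs over `R`: those `(a, b)` with `a * d - b * c = 1` for some `c`, `d`. -/
def UnimodularPair (R : Type*) [CommRing R] : Type _ :=
  {v : R × R // ∃ w : R × R, pairDet v w = 1}

/-- The relation identifying unimodular pairs that are equal up to sign. -/
def signSetoid (R : Type*) [CommRing R] : Setoid (UnimodularPair R) where
  r v w := v.1 = w.1 ∨ v.1 = -w.1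
  iseqv :=
    { refl := fun _ => Or.inl rfl
      symm := by
        rintro v w (h | h)
        · exact Or.inl h.symm
        · exact Or.inr (by rw [h, neg_neg])
      trans := by
        rintro u v w (h | h) (k | k)
        · exact Or.inl (h.trans k)
        · exact Or.inr (h.trans k)
        · exact Or.inr (by rw [h, k])
        · exact Or.inl (by rw [h, k, neg_neg]) }

/-- The vertices of the Platonic graph: unimodular pairs up to sign. -/
def PlatonicVertex (R : Type*) [CommRing R] : Type _ :=
  Quotient (signSetoid R)

/-- The class `[a, b]` of a unimodular pair `(a, b)`. -/
def PlatonicVertex.mk {R : Type*} [CommRing R] (v : UnimodularPair R) : PlatonicVertex R :=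
  Quotient.mk (signSetoid R) v

/-- The Platonic graph over `R`: `[a, b]` and `[c, d]` are adjacent when `a * d - b * c = ± 1`.
The condition `x ≠ y` only has an effect over the zero ring: otherwise a pair and its negative
have determinant `0`, which is not `± 1`. -/
def platonicGraph (R : Type*) [CommRing R] : SimpleGraph (PlatonicVertex R) where
  Adj x y := x ≠ y ∧ ∃ v w : UnimodularPair R, PlatonicVertex.mk v = x ∧ PlatonicVertex.mk w = y ∧
    (pairDet v.1 w.1 = 1 ∨ pairDet v.1 w.1 = -1)
  symm := ⟨by
    rintro x y ⟨hne, v, w, hv, hw, h⟩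
    have e : pairDet w.1 v.1 = -pairDet v.1 w.1 := by unfold pairDet; ring
    refine ⟨hne.symm, w, v, hw, hv, ?_⟩
    rcases h with h | h
    · exact Or.inr (by rw [e, h])
    · exact Or.inl (by rw [e, h, neg_neg])⟩
  loopless := ⟨fun _ h => h.1 rfl⟩

noncomputable instance (R : Type*) [CommRing R] [Finite R] : Fintype (PlatonicVertex R) :=
  haveI : Finite (UnimodularPair R) := Subtype.finite
  haveI : Finite (PlatonicVertex R) := Quotient.finite _
  Fintype.ofFinite _

noncomputable instance (R : Type*) [CommRing R] : DecidableEq (PlatonicVertex R) :=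
  Classical.decEq _

noncomputable instance (R : Type*) [CommRing R] : DecidableRel (platonicGraph R).Adj :=
  Classical.decRel _

/-- The non-trivial eigenvalues of a connected `d`-regular graph: the eigenvalues of its adjacency
matrix other than the degree `d`. -/
def nontrivialEigenvalues {V : Type*} [Fintype V] [DecidableEq V] (G : SimpleGraph V)
    [DecidableRel G.Adj] (d : ℕ) : Set ℝ :=
  {μ | Module.End.HasEigenvalue (Matrix.toLin' (G.adjMatrix ℝ)) μ ∧ μ ≠ d}

/-- The isoperimetric constant of a finite graph with at least two vertices: the minimum of
`e(U, W) / min (|U|, |W|)` over all partitions of the vertices into two non-empty sets `U` and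
`W = Uᶜ`, where `e(U, W)` is the number of edges between `U` and `W`. The infimum is over a finite
set, which is non-empty as there are two vertices or more. -/
noncomputable def isoperimetricConstant {V : Type*} [Fintype V] [DecidableEq V]
    (G : SimpleGraph V) [DecidableRel G.Adj] : ℝ :=
  sInf {r : ℝ | ∃ U : Finset V, U.Nonempty ∧ Uᶜ.Nonempty ∧
    r = ((G.interedges U Uᶜ).card : ℝ) / ((min U.card Uᶜ.card : ℕ) : ℝ)}

/-! Everything follows from one estimate: on functions of sum zero the adjacency operator of the
graph has squared norm at most `N ^ 2 / p`. The estimate is proved upstairs, on unimodular pairs,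
for the operator `T` with kernel `detOneKernel`. There it is multiplicative, since both the pairs
and the kernel split over a product of rings.

Over a finite local ring with maximal ideal `m`, the `(v, u)` entry of `TᵀT` counts the `x` of
determinant one with both `v` and `u`. It is 1 when `det(v, u)` is a unit. The remaining pairs form
an equivalence relation with kernel `E`, so `TᵀT = J - E + E ∘ TᵀT` with `J` all ones and `∘` the
entrywise product. On sum zero `J` vanishes, `-E` is negative semidefinite, and the last term has
row sums `|R||m|`, which bound it (`biregularGap_of_isLocalRing`). For `ZMod (q ^ k)` this is `q ^
(2 * k) / q`. `BiregularGap.prod` and the Chinese remainder theorem then give all `N`.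

Pulling functions back along the two-to-one map from pairs to vertices transfers the estimate to the
graph. Eigenvectors with eigenvalue other than `N` have sum zero, which gives the spectral bound;
centred indicator functions give connectivity and the isoperimetric bound. -/

open Finset

/-- A nonnegative kernel `M` on a finite type with all row and column sums equal to `d`, whose
square norm on functions of sum zero is at most `s`. -/
structure BiregularGap {X : Type*} [Fintype X] (M : X → X → ℝ) (d s : ℝ) : Prop where
  nonneg : ∀ x y, 0 ≤ M x y
  row_sum : ∀ x, ∑ y, M x y = d
  col_sum : ∀ y, ∑ x, M x y = d
  sq_le : ∀ f : X → ℝ, ∑ x, f x = 0 → ∑ x, (∑ y, M x y * f y) ^ 2 ≤ s * ∑ x, f x ^ 2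

/-! ### Gaps of nonnegative kernels and their tensor products -/

section Kernel

variable {X Y : Type*} [Fintype X] [Fintype Y]

/-- The Schur test for a nonnegative kernel with constant row and column sums. -/
theorem sum_kernel_sq_le {M : X → X → ℝ} {d : ℝ} (h0 : ∀ x y, 0 ≤ M x y)
    (hr : ∀ x, ∑ y, M x y = d) (hc : ∀ y, ∑ x, M x y = d) (f : X → ℝ) :
    ∑ x, (∑ y, M x y * f y) ^ 2 ≤ d ^ 2 * ∑ x, f x ^ 2 := by
  have h1 : ∀ x, (∑ y, M x y * f y) ^ 2 ≤ d * ∑ y, M x y * f y ^ 2 := by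
    intro x
    -- Cauchy–Schwarz with weights `M x y`.
    have := Finset.sum_sq_le_sum_mul_sum_of_sq_le_mul univ (r := fun y => M x y * f y)
      (f := fun y => M x y) (g := fun y => M x y * f y ^ 2)
      (fun y _ => h0 x y) (fun y _ => mul_nonneg (h0 x y) (sq_nonneg _)) (fun y _ => le_of_eq (by ring))
    rwa [hr] at this
  calc ∑ x, (∑ y, M x y * f y) ^ 2 ≤ ∑ x, d * ∑ y, M x y * f y ^ 2 :=
        sum_le_sum fun x _ => h1 x
    _ = d * ∑ y, ∑ x, M x y * f y ^ 2 := by rw [← mul_sum, sum_comm]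
    _ = d * ∑ y, d * f y ^ 2 := by simp only [← sum_mul, hc]
    _ = d ^ 2 * ∑ x, f x ^ 2 := by rw [← mul_sum]; ring

theorem sum_add_sq_of_sum_eq_zero (a : X → ℝ) (b : X → Y → ℝ) (hb : ∀ x, ∑ y, b x y = 0) :
    ∑ x, ∑ y, (a x + b x y) ^ 2
      = Fintype.card Y * ∑ x, a x ^ 2 + ∑ x, ∑ y, b x y ^ 2 := by
  rw [mul_sum, ← sum_add_distrib]
  refine sum_congr rfl fun x _ => ?_
  have : ∀ y, (a x + b x y) ^ 2 = a x ^ 2 + 2 * a x * b x y + b x y ^ 2 := fun y => by ring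
  simp only [this, sum_add_distrib, ← mul_sum, hb]
  simp

theorem BiregularGap.congr {M : X → X → ℝ} {K : Y → Y → ℝ} {d s : ℝ} (hM : BiregularGap M d s)
    (e : Y ≃ X) (he : ∀ y z, K y z = M (e y) (e z)) : BiregularGap K d s where
  nonneg y z := by rw [he]; exact hM.nonneg _ _
  row_sum y := by
    simp only [he]; rw [e.sum_comp (fun x => M (e y) x)]; exact hM.row_sum _
  col_sum y := by
    simp only [he]; rw [e.sum_comp (fun x => M x (e y))]; exact hM.col_sum _
  sq_le f hf := by
    have h := hM.sq_le (fun x => f (e.symm x)) (by rw [e.symm.sum_comp f]; exact hf)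
    rw [e.symm.sum_comp (fun y => f y ^ 2), ← e.sum_comp] at h
    refine le_of_eq_of_le (sum_congr rfl fun y _ => ?_) h
    rw [← e.sum_comp (fun x => M (e y) x * f (e.symm x))]
    simp [he]

theorem BiregularGap.mono {M : X → X → ℝ} {d s t : ℝ} (hM : BiregularGap M d s) (h : s ≤ t) :
    BiregularGap M d t where
  nonneg := hM.nonneg
  row_sum := hM.row_sum
  col_sum := hM.col_sum
  sq_le f hf := (hM.sq_le f hf).trans
    (mul_le_mul_of_nonneg_right h (sum_nonneg fun _ _ => sq_nonneg _))

/-- Split `f` into its mean `g` over the fibres `Y` and a part `h` of sum zero on each fibre. The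
operator preserves this orthogonal splitting. On `g` it acts as `e` times `M`; on `h`, `K`
contributes its gap `t` and `M` at most `d ^ 2` by the Schur test. -/
theorem BiregularGap.prod {M : X → X → ℝ} {K : Y → Y → ℝ} {d e s t r : ℝ}
    (hM : BiregularGap M d s) (hK : BiregularGap K e t)
    (h1 : e ^ 2 * s ≤ r) (h2 : d ^ 2 * t ≤ r) :
    BiregularGap (fun a b : X × Y => M a.1 b.1 * K a.2 b.2) (d * e) r where
  nonneg a b := mul_nonneg (hM.nonneg _ _) (hK.nonneg _ _)
  row_sum a := by
    simp only [Fintype.sum_prod_type, ← mul_sum, hK.row_sum, ← sum_mul, hM.row_sum]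
  col_sum a := by
    simp only [Fintype.sum_prod_type, ← mul_sum, hK.col_sum, ← sum_mul, hM.col_sum]
  sq_le f hf := by
    rcases isEmpty_or_nonempty Y with hY | hY
    · simp
    have hm : (Fintype.card Y : ℝ) ≠ 0 := by positivity
    set m : ℝ := (Fintype.card Y : ℝ)
    simp only [Fintype.sum_prod_type] at hf ⊢
    set g : X → ℝ := fun x => (∑ y, f (x, y)) / m with hg
    set h : X → Y → ℝ := fun x y => f (x, y) - g x with hh
    have hf' : ∀ x y, f (x, y) = g x + h x y := fun x y => by simp [hh]
    have hg0 : ∑ x, g x = 0 := by rw [hg]; simp only [← sum_div, hf, zero_div]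
    have hh0 : ∀ x, ∑ y, h x y = 0 := fun x => by
      simp only [hh, sum_sub_distrib, sum_const, card_univ, nsmul_eq_mul, hg]
      rw [mul_div_cancel₀ _ hm, sub_self]
    have hT : ∀ x y, ∑ x', ∑ y', M x x' * K y y' * f (x', y')
        = e * ∑ x', M x x' * g x' + ∑ x', M x x' * ∑ y', K y y' * h x' y' := fun x y => by
      rw [mul_sum, ← sum_add_distrib]
      refine sum_congr rfl fun x' _ => ?_
      simp only [hf', mul_add, sum_add_distrib, mul_assoc, ← mul_sum, ← sum_mul]
      rw [hK.row_sum]; ring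
    have hT0 : ∀ x, ∑ y, ∑ x', M x x' * ∑ y', K y y' * h x' y' = 0 := fun x => by
      rw [sum_comm]
      refine sum_eq_zero fun x' _ => ?_
      rw [← mul_sum, sum_comm]
      simp only [← sum_mul, hK.col_sum, ← mul_sum, hh0, mul_zero]
    simp only [hT]
    simp only [hf']
    rw [sum_add_sq_of_sum_eq_zero _ _ hT0, sum_add_sq_of_sum_eq_zero _ _ hh0]
    have b1 := hM.sq_le g hg0
    have b2 : ∑ x, ∑ y, (∑ x', M x x' * ∑ y', K y y' * h x' y') ^ 2
        ≤ d ^ 2 * (t * ∑ x, ∑ y, h x y ^ 2) := by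
      rw [sum_comm]
      calc _ ≤ ∑ y, d ^ 2 * ∑ x, (∑ y', K y y' * h x y') ^ 2 :=
            sum_le_sum fun y _ => sum_kernel_sq_le hM.nonneg hM.row_sum hM.col_sum
              (fun x' => ∑ y', K y y' * h x' y')
        _ = d ^ 2 * ∑ x, ∑ y, (∑ y', K y y' * h x y') ^ 2 := by rw [← mul_sum, sum_comm]
        _ ≤ _ := by
            rw [mul_sum (s := univ) (a := t)]
            gcongr with x
            exact hK.sq_le _ (hh0 x)
    have n1 : 0 ≤ ∑ x, g x ^ 2 := sum_nonneg fun _ _ => sq_nonneg _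
    have n2 : 0 ≤ ∑ x, ∑ y, h x y ^ 2 := sum_nonneg fun _ _ => sum_nonneg fun _ _ => sq_nonneg _
    have m0 : 0 ≤ m := Nat.cast_nonneg _
    simp only [mul_pow, ← mul_sum]
    calc _ ≤ m * (e ^ 2 * (s * ∑ x, g x ^ 2)) + d ^ 2 * (t * ∑ x, ∑ y, h x y ^ 2) := by gcongr
      _ = (e ^ 2 * s) * (m * ∑ x, g x ^ 2) + (d ^ 2 * t) * ∑ x, ∑ y, h x y ^ 2 := by ring
      _ ≤ r * (m * ∑ x, g x ^ 2) + r * ∑ x, ∑ y, h x y ^ 2 := by gcongr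
      _ = _ := by ring

/-- The kernel of an equivalence relation is positive semidefinite. -/
theorem sum_setoid_nonneg (r : Setoid X) [DecidableRel r] (f : X → ℝ) :
    0 ≤ ∑ x, ∑ y, (if r x y then 1 else 0) * (f x * f y) := by
  classical
  have : ∑ x, ∑ y, (if r x y then 1 else 0) * (f x * f y)
      = ∑ c : Quotient r, (∑ x, if (⟦x⟧ : Quotient r) = c then f x else 0) ^ 2 := by
    symm
    simp only [sq, sum_mul_sum]
    rw [sum_comm]
    refine sum_congr rfl fun x _ => ?_
    rw [sum_comm]
    refine sum_congr rfl fun y _ => ?_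
    have : (⟦x⟧ : Quotient r) = ⟦y⟧ ↔ r x y := Quotient.eq
    simp [this]
  rw [this]
  exact sum_nonneg fun _ _ => sq_nonneg _

end Kernel

/-! ### The determinant-one kernel and its gap over a finite local ring -/

section Unimodular

variable {R : Type*} [CommRing R]

noncomputable instance [Finite R] : Fintype (UnimodularPair R) :=
  haveI : Finite (UnimodularPair R) := Subtype.finite
  Fintype.ofFinite _

theorem pairDet_swap (v w : R × R) : pairDet w v = -pairDet v w := by
  unfold pairDet; ring

theorem pairDet_neg_left (v w : R × R) : pairDet (-v) w = -pairDet v w := by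
  simp only [pairDet, Prod.fst_neg, Prod.snd_neg]; ring

theorem pairDet_neg_right (v w : R × R) : pairDet v (-w) = -pairDet v w := by
  simp only [pairDet, Prod.fst_neg, Prod.snd_neg]; ring

theorem exists_pairDet_eq_one_of_right {v w : R × R} (h : pairDet v w = 1) :
    ∃ u : R × R, pairDet w u = 1 :=
  ⟨-v, by rw [pairDet_neg_right, pairDet_swap v w, neg_neg, h]⟩

/-- The negative of a unimodular pair. -/
def UnimodularPair.neg (v : UnimodularPair R) : UnimodularPair R :=
  ⟨-v.1, by
    obtain ⟨w, hw⟩ := v.2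
    exact ⟨-w, by rw [pairDet_neg_left, pairDet_neg_right, neg_neg, hw]⟩⟩

open Classical in
/-- The indicator of the pairs of determinant one. -/
noncomputable def detOneKernel (R : Type*) [CommRing R] (v w : UnimodularPair R) : ℝ :=
  if pairDet v.1 w.1 = 1 then 1 else 0

theorem detOneKernel_nonneg (v w : UnimodularPair R) : 0 ≤ detOneKernel R v w := by
  unfold detOneKernel; split_ifs <;> norm_num

theorem detOneKernel_swap (v w : UnimodularPair R) :
    detOneKernel R w v = detOneKernel R v.neg w := by
  unfold detOneKernel
  rw [pairDet_swap v.1 w.1, UnimodularPair.neg, pairDet_neg_left]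

/-- The pairs `u` with `pairDet x u = 1` are the translates by multiples of `x` of one of them. -/
def detOneEquiv (x v : UnimodularPair R) (h : pairDet x.1 v.1 = 1) :
    R ≃ {u : UnimodularPair R // pairDet x.1 u.1 = 1} where
  toFun s :=
    have hs : pairDet x.1 (v.1 + s • x.1) = 1 := by
      simp only [pairDet, Prod.fst_add, Prod.snd_add, Prod.smul_fst, Prod.smul_snd,
        smul_eq_mul] at h ⊢
      linear_combination h
    ⟨⟨v.1 + s • x.1, exists_pairDet_eq_one_of_right hs⟩, hs⟩
  invFun u := pairDet u.1.1 v.1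
  left_inv s := by
    simp only [pairDet, Prod.fst_add, Prod.snd_add, Prod.smul_fst, Prod.smul_snd,
      smul_eq_mul] at h ⊢
    linear_combination s * h
  right_inv u := by
    obtain ⟨u, hu⟩ := u
    refine Subtype.ext (Subtype.ext (Prod.ext ?_ ?_)) <;>
    simp only [pairDet, Prod.fst_add, Prod.snd_add, Prod.smul_fst, Prod.smul_snd,
      smul_eq_mul] at h hu ⊢
    · linear_combination u.1.1 * h - v.1.1 * hu
    · linear_combination u.1.2 * h - v.1.2 * hu

theorem sum_detOneKernel_mul [Fintype R] (x v : UnimodularPair R) (h : pairDet x.1 v.1 = 1)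
    (g : UnimodularPair R → ℝ) :
    ∑ u, detOneKernel R x u * g u = ∑ s : R, g (detOneEquiv x v h s).1 := by
  classical
  rw [(detOneEquiv x v h).sum_comp (fun u => g u.1)]
  simp only [detOneKernel, ite_mul, one_mul, zero_mul]
  rw [← sum_filter, sum_subtype _ (p := fun u : UnimodularPair R => pairDet x.1 u.1 = 1)]
  simp

theorem UnimodularPair.exists_right (x : UnimodularPair R) :
    ∃ v : UnimodularPair R, pairDet x.1 v.1 = 1 := by
  obtain ⟨w, hw⟩ := x.2
  exact ⟨⟨w, exists_pairDet_eq_one_of_right hw⟩, hw⟩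

theorem sum_detOneKernel [Fintype R] (x : UnimodularPair R) :
    ∑ u, detOneKernel R x u = Fintype.card R := by
  obtain ⟨v, hv⟩ := x.exists_right
  have := sum_detOneKernel_mul x v hv (fun _ => 1)
  simpa using this

theorem sum_detOneKernel_left [Fintype R] (x : UnimodularPair R) :
    ∑ u, detOneKernel R u x = Fintype.card R := by
  simp only [detOneKernel_swap x]
  exact sum_detOneKernel x.neg

/-- Two unimodular pairs over a local ring are equivalent when their determinant lies in the
maximal ideal. -/
def nonunitDetSetoid (R : Type*) [CommRing R] [IsLocalRing R] : Setoid (UnimodularPair R) where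
  r v u := pairDet v.1 u.1 ∈ IsLocalRing.maximalIdeal R
  iseqv :=
    { refl := fun v => by
        have : pairDet v.1 v.1 = 0 := by unfold pairDet; ring
        rw [this]; exact Ideal.zero_mem _
      symm := fun {v u} h => by rw [pairDet_swap v.1 u.1]; exact neg_mem h
      trans := fun {v u t} h k => by
        -- With `pairDet u.1 w = 1`, the three-term Plücker relation expresses `pairDet v.1 t.1`
        -- through the two determinants in the ideal.
        obtain ⟨w, hw⟩ := u.2
        have : pairDet v.1 t.1
            = pairDet v.1 w * pairDet u.1 t.1 + pairDet t.1 w * pairDet v.1 u.1 := by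
          unfold pairDet at hw ⊢
          linear_combination (-(v.1.1 * t.1.2 - v.1.2 * t.1.1)) * hw
        rw [this]
        exact add_mem (Ideal.mul_mem_left _ _ k) (Ideal.mul_mem_left _ _ h) }

/-- The number of `x` having determinant one with two pairs of invertible determinant is one. -/
theorem sum_detOneKernel_mul_of_isUnit [Fintype R] (v u : UnimodularPair R)
    (h : IsUnit (pairDet v.1 u.1)) :
    ∑ x, detOneKernel R x v * detOneKernel R x u = 1 := by
  classical
  obtain ⟨k, hk⟩ := h.exists_left_inv
  -- Cramer's rule: `k` inverts `pairDet v.1 u.1`, and `v - u` has that same determinant with both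
  -- `v` and `u`.
  have hv : pairDet (k • (v.1 - u.1)) v.1 = 1 := by
    simp only [pairDet, Prod.smul_fst, Prod.smul_snd, Prod.fst_sub, Prod.snd_sub,
      smul_eq_mul] at hk ⊢
    linear_combination hk
  have hu : pairDet (k • (v.1 - u.1)) u.1 = 1 := by
    simp only [pairDet, Prod.smul_fst, Prod.smul_snd, Prod.fst_sub, Prod.snd_sub,
      smul_eq_mul] at hk ⊢
    linear_combination hk
  let y : UnimodularPair R := ⟨k • (v.1 - u.1), v.1, hv⟩
  refine (sum_eq_single y ?_ ?_).trans ?_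
  · intro x _ hx
    simp only [detOneKernel, mul_ite, mul_one, mul_zero, ite_eq_right_iff]
    intro h2
    simp only [one_ne_zero, imp_false]
    intro h1
    simp only [pairDet] at h1 h2 hk
    refine hx (Subtype.ext (Prod.ext ?_ ?_))
    · change x.1.1 = k * (v.1.1 - u.1.1)
      linear_combination (-x.1.1) * hk + k * v.1.1 * h2 - k * u.1.1 * h1
    · change x.1.2 = k * (v.1.2 - u.1.2)
      linear_combination (-x.1.2) * hk + k * v.1.2 * h2 - k * u.1.2 * h1
  · simp
  · simp [detOneKernel, y, hv, hu]

-- Sum over `x` last. Each of the `|R|` elements `x` with `det(x, v) = 1` sees exactly the `u = v +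
-- s x`, and `det(v, v + s x) = -s`, so `u` is equivalent to `v` precisely when `s` lies in the
-- maximal ideal.
open Classical in
theorem sum_detOneKernel_mul_nonunit [Fintype R] [IsLocalRing R] (v : UnimodularPair R) :
    ∑ u, (if nonunitDetSetoid R v u then 1 else 0)
        * ∑ x, detOneKernel R x v * detOneKernel R x u
      = Fintype.card R * Fintype.card (IsLocalRing.maximalIdeal R) := by
  simp only [mul_sum]
  rw [sum_comm]
  have key : ∀ x, ∑ u, (if nonunitDetSetoid R v u then (1 : ℝ) else 0)
      * (detOneKernel R x v * detOneKernel R x u)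
      = detOneKernel R x v * Fintype.card (IsLocalRing.maximalIdeal R) := by
    intro x
    by_cases h : pairDet x.1 v.1 = 1
    · have := sum_detOneKernel_mul x v h (fun u => if nonunitDetSetoid R v u then 1 else 0)
      have e : ∀ u, (if nonunitDetSetoid R v u then (1 : ℝ) else 0)
          * (detOneKernel R x v * detOneKernel R x u)
          = detOneKernel R x v * (detOneKernel R x u
            * if nonunitDetSetoid R v u then (1 : ℝ) else 0) := fun u => by ring
      simp only [e]
      rw [← mul_sum, this]
      congr 1
      have hs : ∀ s : R, nonunitDetSetoid R v (detOneEquiv x v h s).1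
          ↔ s ∈ IsLocalRing.maximalIdeal R := by
        intro s
        change pairDet v.1 (v.1 + s • x.1) ∈ _ ↔ _
        have : pairDet v.1 (v.1 + s • x.1) = -s := by
          simp only [pairDet, Prod.fst_add, Prod.snd_add, Prod.smul_fst, Prod.smul_snd,
            smul_eq_mul] at h ⊢
          linear_combination (-s) * h
        rw [this, neg_mem_iff]
      simp only [hs]
      rw [Fintype.card_subtype, sum_boole]
    · simp [detOneKernel, h]
  simp only [key]
  rw [← sum_mul, sum_detOneKernel_left]

theorem biregularGap_of_isLocalRing [Fintype R] [IsLocalRing R]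
    [Fintype (IsLocalRing.maximalIdeal R)] :
    BiregularGap (detOneKernel R) (Fintype.card R)
      (Fintype.card R * Fintype.card (IsLocalRing.maximalIdeal R)) where
  nonneg := detOneKernel_nonneg
  row_sum := sum_detOneKernel
  col_sum := sum_detOneKernel_left
  sq_le f hf := by
    classical
    set c : UnimodularPair R → UnimodularPair R → ℝ :=
      fun v u => ∑ x, detOneKernel R x v * detOneKernel R x u with hc
    set E : UnimodularPair R → UnimodularPair R → ℝ :=
      fun v u => if nonunitDetSetoid R v u then 1 else 0 with hE
    have c0 : ∀ v u, 0 ≤ c v u := fun v u =>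
      sum_nonneg fun x _ => mul_nonneg (detOneKernel_nonneg _ _) (detOneKernel_nonneg _ _)
    have E0 : ∀ v u, 0 ≤ E v u := fun v u => by simp only [hE]; split_ifs <;> norm_num
    have cs : ∀ v u, c v u = c u v := fun v u => sum_congr rfl fun x _ => mul_comm _ _
    have Es : ∀ v u, E v u = E u v := fun v u => by
      have : nonunitDetSetoid R v u ↔ nonunitDetSetoid R u v :=
        ⟨(nonunitDetSetoid R).symm, (nonunitDetSetoid R).symm⟩
      simp only [hE, this]
    -- The decomposition `TᵀT = J - E + E ∘ TᵀT`: off the equivalence relation the determinant is a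
    -- unit and `c = 1`.
    have split : ∀ v u, c v u = 1 - E v u + E v u * c v u := fun v u => by
      by_cases h : nonunitDetSetoid R v u
      · simp [hE, h]
      · have hu : IsUnit (pairDet v.1 u.1) := by
          by_contra h'
          exact h ((IsLocalRing.mem_maximalIdeal _).2 h')
        have := sum_detOneKernel_mul_of_isUnit v u hu
        simp only [hc, this, hE, h, if_false]
        norm_num
    have expand : ∑ x, (∑ y, detOneKernel R x y * f y) ^ 2 = ∑ v, ∑ u, c v u * (f v * f u) := by
      have h1 : ∀ x, (∑ y, detOneKernel R x y * f y) ^ 2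
          = ∑ v, ∑ u, detOneKernel R x v * f v * (detOneKernel R x u * f u) := fun x => by
        rw [sq, sum_mul_sum]
      simp only [h1, hc, sum_mul]
      rw [sum_comm]
      refine sum_congr rfl fun v _ => ?_
      rw [sum_comm]
      exact sum_congr rfl fun u _ => sum_congr rfl fun x _ => by ring
    have one : ∑ v, ∑ u, f v * f u = 0 := by rw [← sum_mul_sum, hf, zero_mul]
    have psd := sum_setoid_nonneg (nonunitDetSetoid R) f
    have row : ∀ v, ∑ u, E v u * c v u
        = Fintype.card R * Fintype.card (IsLocalRing.maximalIdeal R) := fun v => by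
      convert! sum_detOneKernel_mul_nonunit v
    have schur : ∑ v, ∑ u, E v u * c v u * (f v * f u)
        ≤ Fintype.card R * Fintype.card (IsLocalRing.maximalIdeal R) * ∑ v, f v ^ 2 := by
      have h1 : ∑ v, ∑ u, E v u * c v u * f v ^ 2
          = Fintype.card R * Fintype.card (IsLocalRing.maximalIdeal R) * ∑ v, f v ^ 2 := by
        simp only [← sum_mul, row, ← mul_sum]
      have h2 : ∑ v, ∑ u, E v u * c v u * f u ^ 2 = ∑ v, ∑ u, E v u * c v u * f v ^ 2 := by
        rw [sum_comm]
        exact sum_congr rfl fun v _ => sum_congr rfl fun u _ => by rw [Es, cs]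
      have h3 : ∑ v, ∑ u, E v u * c v u * (f v * f u)
          ≤ ∑ v, ∑ u, (E v u * c v u * f v ^ 2 + E v u * c v u * f u ^ 2) / 2 :=
        -- The arithmetic-geometric mean inequality `2 f(v) f(u) ≤ f(v)² + f(u)²`, weighted by the
        -- symmetric kernel `E * c`.
        sum_le_sum fun v _ => sum_le_sum fun u _ => by
          nlinarith [mul_nonneg (mul_nonneg (E0 v u) (c0 v u)) (sq_nonneg (f v - f u))]
      simp only [← sum_div, sum_add_distrib, h2] at h3
      rw [← h1]
      linarith
    rw [expand]
    have : ∑ v, ∑ u, c v u * (f v * f u) = ∑ v, ∑ u, f v * f u - ∑ v, ∑ u, E v u * (f v * f u)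
        + ∑ v, ∑ u, E v u * c v u * (f v * f u) := by
      simp only [← sum_sub_distrib, ← sum_add_distrib]
      refine sum_congr rfl fun v _ => sum_congr rfl fun u _ => ?_
      linear_combination (f v * f u) * split v u
    rw [this, one]
    linarith

end Unimodular

/-! ### The gap over `ZMod N` by the Chinese remainder theorem -/

section ZModGap

theorem pairDet_map {R S : Type*} [CommRing R] [CommRing S] (φ : R →+* S) (v w : R × R) :
    pairDet (Prod.map φ φ v) (Prod.map φ φ w) = φ (pairDet v w) := by
  simp [pairDet]

/-- A ring isomorphism induces a bijection of unimodular pairs. -/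
def UnimodularPair.mapEquiv {R S : Type*} [CommRing R] [CommRing S] (φ : R ≃+* S) :
    UnimodularPair R ≃ UnimodularPair S :=
  Equiv.subtypeEquiv (Equiv.prodCongr φ.toEquiv φ.toEquiv) fun v => by
    constructor
    · rintro ⟨w, hw⟩
      exact ⟨Prod.map φ φ w, (pairDet_map φ.toRingHom v w).trans (by rw [hw, map_one])⟩
    · rintro ⟨w, hw⟩
      refine ⟨Prod.map φ.symm φ.symm w, φ.injective ?_⟩
      refine (pairDet_map φ.toRingHom v _).symm.trans ?_
      rw [map_one, ← hw]
      congr 1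
      ext <;> simp

/-- A unimodular pair over a product ring is a pair of unimodular pairs. -/
def UnimodularPair.prodEquiv (R S : Type*) [CommRing R] [CommRing S] :
    UnimodularPair (R × S) ≃ UnimodularPair R × UnimodularPair S where
  toFun v := (⟨(v.1.1.1, v.1.2.1), by
      obtain ⟨w, hw⟩ := v.2
      exact ⟨(w.1.1, w.2.1), congrArg Prod.fst hw⟩⟩,
    ⟨(v.1.1.2, v.1.2.2), by
      obtain ⟨w, hw⟩ := v.2
      exact ⟨(w.1.2, w.2.2), congrArg Prod.snd hw⟩⟩)
  invFun v := ⟨((v.1.1.1, v.2.1.1), (v.1.1.2, v.2.1.2)), by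
      obtain ⟨w, hw⟩ := v.1.2
      obtain ⟨u, hu⟩ := v.2.2
      exact ⟨((w.1, u.1), (w.2, u.2)), Prod.ext hw hu⟩⟩
  left_inv _ := rfl
  right_inv _ := rfl

theorem detOneKernel_prod {R S : Type*} [CommRing R] [CommRing S] (v w : UnimodularPair (R × S)) :
    detOneKernel (R × S) v w
      = detOneKernel R (UnimodularPair.prodEquiv R S v).1 (UnimodularPair.prodEquiv R S w).1
        * detOneKernel S (UnimodularPair.prodEquiv R S v).2
          (UnimodularPair.prodEquiv R S w).2 := by
  have : pairDet v.1 w.1 = 1 ↔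
      pairDet (UnimodularPair.prodEquiv R S v).1.1 (UnimodularPair.prodEquiv R S w).1.1 = 1 ∧
      pairDet (UnimodularPair.prodEquiv R S v).2.1 (UnimodularPair.prodEquiv R S w).2.1 = 1 :=
    Prod.ext_iff
  simp only [detOneKernel, this]
  split_ifs <;> simp_all

theorem detOneKernel_mapEquiv {R S : Type*} [CommRing R] [CommRing S] (φ : R ≃+* S)
    (v w : UnimodularPair R) :
    detOneKernel R v w
      = detOneKernel S (UnimodularPair.mapEquiv φ v) (UnimodularPair.mapEquiv φ w) := by
  have : pairDet v.1 w.1 = 1 ↔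
      pairDet (UnimodularPair.mapEquiv φ v).1 (UnimodularPair.mapEquiv φ w).1 = 1 := by
    have h : pairDet (UnimodularPair.mapEquiv φ v).1 (UnimodularPair.mapEquiv φ w).1
      = φ (pairDet v.1 w.1) := pairDet_map φ.toRingHom v.1 w.1
    rw [h]
    exact (map_eq_one_iff φ φ.injective).symm
  classical
  exact if_congr this rfl rfl

/-- The nonunits are the classes of multiples of `q`, which are closed under addition. -/
theorem isLocalRing_zmod_prime_pow {q k : ℕ} (hq : q.Prime) (hk : 0 < k) :
    IsLocalRing (ZMod (q ^ k)) := by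
  have : Fact (1 < q ^ k) := ⟨Nat.one_lt_pow hk.ne' hq.one_lt⟩
  have : NeZero (q ^ k) := ⟨(pow_pos hq.pos k).ne'⟩
  refine IsLocalRing.of_nonunits_add fun a b ha hb => ?_
  rw [mem_nonunits_iff] at *
  rw [← ZMod.natCast_zmod_val a, ZMod.isUnit_natCast_iff_not_dvd_pow hq hk, not_not] at ha
  rw [← ZMod.natCast_zmod_val b, ZMod.isUnit_natCast_iff_not_dvd_pow hq hk, not_not] at hb
  rw [← ZMod.natCast_zmod_val a, ← ZMod.natCast_zmod_val b, ← Nat.cast_add,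
    ZMod.isUnit_natCast_iff_not_dvd_pow hq hk, not_not]
  exact dvd_add ha hb

theorem card_maximalIdeal_zmod_prime_pow {q k : ℕ} (hq : q.Prime) (hk : 0 < k)
    [IsLocalRing (ZMod (q ^ k))] :
    Nat.card (IsLocalRing.maximalIdeal (ZMod (q ^ k))) = q ^ (k - 1) := by
  classical
  have : NeZero (q ^ k) := ⟨(pow_pos hq.pos k).ne'⟩
  have h1 := ZMod.card_units_eq_totient (q ^ k)
  rw [Nat.totient_prime_pow hq hk] at h1
  have h2 : Fintype.card (ZMod (q ^ k))ˣ
      = Fintype.card {x : ZMod (q ^ k) // ¬ x ∈ IsLocalRing.maximalIdeal (ZMod (q ^ k))} := by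
    refine Fintype.card_congr (Equiv.ofBijective (fun u => ⟨u, by simp⟩) ⟨?_, ?_⟩)
    · exact fun u v huv => Units.ext (congrArg Subtype.val huv)
    · rintro ⟨x, hx⟩
      obtain ⟨u, rfl⟩ : IsUnit x := by simpa using hx
      exact ⟨u, rfl⟩
  have h3 := Fintype.card_subtype_compl
    (fun x : ZMod (q ^ k) => x ∈ IsLocalRing.maximalIdeal (ZMod (q ^ k)))
  have h4 := Fintype.card_subtype_le
    (fun x : ZMod (q ^ k) => x ∈ IsLocalRing.maximalIdeal (ZMod (q ^ k)))
  rw [ZMod.card] at h3 h4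
  rw [Nat.card_eq_fintype_card]
  rw [← h2, h1] at h3
  have h5 : q ^ k = q ^ (k - 1) * (q - 1) + q ^ (k - 1) := by
    obtain ⟨j, rfl⟩ := Nat.exists_eq_succ_of_ne_zero hk.ne'
    obtain ⟨r, rfl⟩ := Nat.exists_eq_succ_of_ne_zero hq.ne_zero
    simp [pow_succ]; ring
  change Fintype.card {x : ZMod (q ^ k) // x ∈ IsLocalRing.maximalIdeal (ZMod (q ^ k))} = _
  omega

theorem biregularGap_zmod_prime_pow {q k : ℕ} (hq : q.Prime) (hk : 0 < k) [NeZero (q ^ k)]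
    {p : ℝ} (hp : 0 < p) (hpq : p ≤ q) :
    BiregularGap (detOneKernel (ZMod (q ^ k))) ((q ^ k : ℕ) : ℝ) (((q ^ k : ℕ) : ℝ) ^ 2 / p) := by
  classical
  have := isLocalRing_zmod_prime_pow hq hk
  have h := biregularGap_of_isLocalRing (R := ZMod (q ^ k))
  rw [← Nat.card_eq_fintype_card (α := IsLocalRing.maximalIdeal _),
    card_maximalIdeal_zmod_prime_pow hq hk, ZMod.card] at h
  refine h.mono ?_
  rw [le_div_iff₀ hp]
  obtain ⟨j, rfl⟩ := Nat.exists_eq_succ_of_ne_zero hk.ne'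
  push_cast
  simp only [Nat.succ_eq_add_one]
  calc (q : ℝ) ^ (j + 1) * q ^ j * p ≤ (q : ℝ) ^ (j + 1) * q ^ j * q := by gcongr
    _ = _ := by ring

theorem biregularGap_zmod {p : ℝ} (hp : 0 < p) (N : ℕ) [NeZero N]
    (h : ∀ q : ℕ, q.Prime → q ∣ N → p ≤ q) :
    BiregularGap (detOneKernel (ZMod N)) N ((N : ℝ) ^ 2 / p) := by
  rename_i hN
  revert hN h
  induction N using Nat.recOnPosPrimePosCoprime with
  | prime_pow q k hq hk =>
    intro _ h
    exact biregularGap_zmod_prime_pow hq hk hp (h q hq (dvd_pow_self q hk.ne'))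
  | zero => intro hN; exact absurd rfl hN.out
  | one =>
    intro _ _
    refine ⟨detOneKernel_nonneg, fun x => ?_, fun x => ?_, fun f hf => ?_⟩
    · rw [sum_detOneKernel, ZMod.card]
    · rw [sum_detOneKernel_left, ZMod.card]
    -- Over the zero ring there is at most one pair, so a function of sum zero vanishes.
    · have : Subsingleton (UnimodularPair (ZMod 1)) :=
        ⟨fun a b => Subtype.ext (Subsingleton.elim _ _)⟩
      have : ∀ x, f x = 0 := fun x => by
        rw [Fintype.sum_subsingleton f x] at hf; exact hf
      simp [this]
  | coprime a b ha hb hab iha ihb =>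
    intro _ h
    have : NeZero a := ⟨by omega⟩
    have : NeZero b := ⟨by omega⟩
    have A := iha fun q hq hd => h q hq (hd.mul_right b)
    have B := ihb fun q hq hd => h q hq (hd.mul_left a)
    -- Both `b² · (a² / p)` and `a² · (b² / p)` equal `(a b)² / p`, so no loss occurs.
    have P := (A.prod B (r := ((a * b : ℕ) : ℝ) ^ 2 / p)
      (le_of_eq (by push_cast; ring)) (le_of_eq (by push_cast; ring)))
    have Q := P.congr (UnimodularPair.prodEquiv (ZMod a) (ZMod b)) (detOneKernel_prod)
    have S := Q.congr (UnimodularPair.mapEquiv (ZMod.chineseRemainder hab))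
      (detOneKernel_mapEquiv _)
    rwa [← Nat.cast_mul] at S

end ZModGap

/-! ### Consequences of a gap for a regular graph -/

section GraphGap

variable {V : Type*} [Fintype V] {G : SimpleGraph V} [DecidableRel G.Adj]
  {d : ℕ} {α : ℝ}

theorem SimpleGraph.sum_adjMatrix_row (hG : G.IsRegularOfDegree d) (x : V) :
    ∑ y, G.adjMatrix ℝ x y = d := by
  have := SimpleGraph.adjMatrix_mulVec_const_apply_of_regular (α := ℝ) (a := 1) hG (v := x)
  rw [mul_one] at this
  rw [← this]
  simp only [Matrix.mulVec, dotProduct, Function.const_apply, mul_one]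

theorem SimpleGraph.sum_adjMatrix_mulVec (hG : G.IsRegularOfDegree d) (f : V → ℝ) :
    ∑ x, (G.adjMatrix ℝ).mulVec f x = d * ∑ x, f x := by
  simp only [Matrix.mulVec, dotProduct]
  rw [sum_comm, mul_sum]
  refine sum_congr rfl fun y _ => ?_
  rw [← sum_mul]
  congr 1
  have h : ∀ x, G.adjMatrix ℝ x y = G.adjMatrix ℝ y x := fun x => by
    simp only [SimpleGraph.adjMatrix_apply, G.adj_comm]
  simp only [h]
  exact SimpleGraph.sum_adjMatrix_row hG y

variable [DecidableEq V]

/-- Column sums `d` force `μ ∑ f = d ∑ f` for an eigenvector `f`; as `μ ≠ d`, its sum is zero and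
the gap applies. -/
theorem abs_le_of_mem_nontrivialEigenvalues (hG : G.IsRegularOfDegree d) (hα : 0 ≤ α)
    (h : ∀ f : V → ℝ, ∑ x, f x = 0 →
      ∑ x, ((G.adjMatrix ℝ).mulVec f x) ^ 2 ≤ α ^ 2 * ∑ x, f x ^ 2)
    {μ : ℝ} (hμ : μ ∈ nontrivialEigenvalues G d) : |μ| ≤ α := by
  obtain ⟨⟨f, hf⟩, hne⟩ := hμ.imp_left fun h => h.exists_hasEigenvector
  have hf1 : (G.adjMatrix ℝ).mulVec f = μ • f := by
    have := hf.apply_eq_smul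
    rwa [Matrix.toLin'_apply] at this
  have hs := SimpleGraph.sum_adjMatrix_mulVec hG f
  simp only [hf1, Pi.smul_apply, smul_eq_mul, ← mul_sum] at hs
  have hs0 : ∑ x, f x = 0 := by
    rcases mul_eq_zero.1 (show (μ - d) * ∑ x, f x = 0 by rw [sub_mul, hs, sub_self]) with h | h
    · exact absurd (sub_eq_zero.1 h) hne
    · exact h
  have hb := h f hs0
  simp only [hf1, Pi.smul_apply, smul_eq_mul, mul_pow, ← mul_sum] at hb
  have hpos : 0 < ∑ x, f x ^ 2 := by
    obtain ⟨x, hx⟩ := Function.ne_iff.1 hf.2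
    exact sum_pos' (fun _ _ => sq_nonneg _) ⟨x, mem_univ _, sq_pos_of_ne_zero hx⟩
  exact abs_le_of_sq_le_sq (le_of_mul_le_mul_right hb hpos) hα

/-- Were every eigenvalue `d`, the trace would be `d |V| ≠ 0`, whereas an adjacency matrix has trace
zero. -/
theorem nontrivialEigenvalues_nonempty [Nonempty V] (hd : d ≠ 0) :
    (nontrivialEigenvalues G d).Nonempty := by
  by_contra hempty
  have hA : (G.adjMatrix ℝ).IsHermitian := by
    rw [Matrix.IsHermitian, Matrix.conjTranspose_eq_transpose_of_trivial]
    exact G.isSymm_adjMatrix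
  have hall : ∀ i, hA.eigenvalues i = d := fun i => by
    by_contra hne
    refine hempty ⟨hA.eigenvalues i, ?_, hne⟩
    refine Module.End.hasEigenvalue_of_hasEigenvector
      (x := (hA.eigenvectorBasis i : V → ℝ)) ⟨?_, ?_⟩
    · rw [Module.End.mem_eigenspace_iff, Matrix.toLin'_apply]
      exact hA.mulVec_eigenvectorBasis i
    · intro h0
      refine hA.eigenvectorBasis.orthonormal.ne_zero i ?_
      ext x
      exact congrFun h0 x
  have ht := hA.trace_eq_sum_eigenvalues
  rw [SimpleGraph.trace_adjMatrix] at ht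
  simp [hall, hd] at ht

theorem exists_isGreatest_nontrivialEigenvalues [Nonempty V] (hd : d ≠ 0) :
    ∃ μ, IsGreatest (nontrivialEigenvalues G d) μ := by
  have hfin : (nontrivialEigenvalues G d).Finite :=
    (Module.End.finite_hasEigenvalue (Matrix.toLin' (G.adjMatrix ℝ))).subset fun μ hμ => hμ.1
  obtain ⟨μ, hμ, hmax⟩ := hfin.exists_maximal (nontrivialEigenvalues_nonempty hd)
  exact ⟨μ, hμ, fun ν hν => (le_total ν μ).elim id fun h => hmax hν h⟩

/-- The expander mixing bound for a set and its complement. -/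
theorem SimpleGraph.mul_card_mul_card_compl_le [Nonempty V] (hG : G.IsRegularOfDegree d)
    (hα : 0 ≤ α)
    (h : ∀ f : V → ℝ, ∑ x, f x = 0 →
      ∑ x, ((G.adjMatrix ℝ).mulVec f x) ^ 2 ≤ α ^ 2 * ∑ x, f x ^ 2) (U : Finset V) :
    (d - α) * (U.card * Uᶜ.card / Fintype.card V) ≤ (G.interedges U Uᶜ).card := by
  set A := G.adjMatrix ℝ with hA
  have hn : (Fintype.card V : ℝ) ≠ 0 := by positivity
  set n : ℝ := (Fintype.card V : ℝ)
  set u : ℝ := (U.card : ℝ)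
  set g : V → ℝ := fun x => if x ∈ U then 1 else 0 with hg
  have hgu : ∑ x, g x = u := by simp [hg, u]
  have hgg : ∀ x, g x * g x = g x := fun x => by simp [hg]
  have hw : (Uᶜ.card : ℝ) = n - u := by
    rw [card_compl, Nat.cast_sub (card_le_univ U)]
  set c : ℝ := u / n
  have hcn : c * n = u := div_mul_cancel₀ _ hn
  -- The indicator of `U` minus its mean. Then `e(U, Uᶜ) = d ‖f‖² - ⟨f, A f⟩`, and `‖f‖² = |U||Uᶜ| /
  -- |V|`.
  set f : V → ℝ := fun x => g x - c with hf
  have hf0 : ∑ x, f x = 0 := by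
    simp only [hf, sum_sub_distrib, hgu, sum_const, card_univ, nsmul_eq_mul]
    linear_combination -hcn
  have hf2 : ∑ x, f x ^ 2 = u - c * u := by
    have : ∀ x, f x ^ 2 = g x - 2 * c * g x + c ^ 2 := fun x => by
      linear_combination hgg x
    simp only [this, sum_add_distrib, sum_sub_distrib, ← mul_sum, hgu, sum_const, card_univ,
      nsmul_eq_mul]
    linear_combination c * hcn
  have hAf : ∀ x, A.mulVec f x = A.mulVec g x - c * d := fun x => by
    have e : f = g - Function.const V c := rfl
    rw [e, Matrix.mulVec_sub, Pi.sub_apply,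
      SimpleGraph.adjMatrix_mulVec_const_apply_of_regular hG, mul_comm]
  have hAg := SimpleGraph.sum_adjMatrix_mulVec hG g
  rw [hgu, ← hA] at hAg
  have hquad : ∑ x, f x * A.mulVec f x = ∑ x, g x * A.mulVec g x - c * d * u := by
    have : ∀ x, f x * A.mulVec f x
        = g x * A.mulVec g x - c * d * g x - c * A.mulVec g x + c ^ 2 * d := fun x => by
      rw [hAf]; simp only [hf]; ring
    simp only [this, sum_add_distrib, sum_sub_distrib, ← mul_sum, hgu, hAg, sum_const, card_univ,
      nsmul_eq_mul]
    linear_combination c * d * hcn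
  have hedge : ((G.interedges U Uᶜ).card : ℝ) = d * u - ∑ x, g x * A.mulVec g x := by
    have h1 : ((G.interedges U Uᶜ).card : ℝ) = ∑ x, ∑ y, g x * (A x y * (1 - g y)) := by
      rw [SimpleGraph.interedges_def, card_filter, sum_product]
      push_cast
      rw [← sum_filter_add_sum_filter_not univ (· ∈ U)]
      have z : ∑ x with x ∉ U, ∑ y, g x * (A x y * (1 - g y)) = 0 :=
        sum_eq_zero fun x hx => sum_eq_zero fun y _ => by
          simp [hg, (mem_filter.1 hx).2]
      rw [z, add_zero, filter_mem_eq_inter, univ_inter]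
      refine sum_congr rfl fun x hx => ?_
      rw [← sum_filter_add_sum_filter_not univ (· ∈ Uᶜ)]
      have z : ∑ y with y ∉ Uᶜ, g x * (A x y * (1 - g y)) = 0 :=
        sum_eq_zero fun y hy => by
          have := (mem_filter.1 hy).2
          rw [mem_compl, not_not] at this
          simp [hg, this]
      rw [z, add_zero, filter_mem_eq_inter, univ_inter]
      refine sum_congr rfl fun y hy => ?_
      rw [mem_compl] at hy
      simp [hg, hx, hy, hA]
    have hd : ∀ x, ∑ y, A x y = d := SimpleGraph.sum_adjMatrix_row hG
    rw [h1]
    simp only [← mul_sum, mul_sub, mul_one, sum_sub_distrib, hd]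
    rw [← sum_mul, hgu, mul_comm]
    rfl
  have hcs : (∑ x, f x * A.mulVec f x) ^ 2 ≤ (α * ∑ x, f x ^ 2) ^ 2 := by
    have n1 : 0 ≤ ∑ x, f x ^ 2 := sum_nonneg fun _ _ => sq_nonneg _
    calc _ ≤ (∑ x, f x ^ 2) * ∑ x, A.mulVec f x ^ 2 := sum_mul_sq_le_sq_mul_sq _ _ _
      _ ≤ (∑ x, f x ^ 2) * (α ^ 2 * ∑ x, f x ^ 2) := by gcongr; exact h f hf0
      _ = _ := by ring
  have hle := (abs_le.1 (abs_le_of_sq_le_sq hcs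
    (mul_nonneg hα (sum_nonneg fun _ _ => sq_nonneg _)))).2
  rw [hquad, hf2] at hle
  rw [hedge, hw]
  have : u * (n - u) / n = u - c * u := by
    rw [div_eq_iff hn]; linear_combination u * hcn
  rw [this]
  linarith

theorem le_isoperimetricConstant [Nontrivial V] (hG : G.IsRegularOfDegree d)
    (hα : 0 ≤ α) (hαd : α ≤ d)
    (h : ∀ f : V → ℝ, ∑ x, f x = 0 →
      ∑ x, ((G.adjMatrix ℝ).mulVec f x) ^ 2 ≤ α ^ 2 * ∑ x, f x ^ 2) :
    (d - α) / 2 ≤ isoperimetricConstant G := by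
  refine le_csInf ?_ ?_
  · obtain ⟨x, y, hxy⟩ := exists_pair_ne V
    exact ⟨_, {x}, singleton_nonempty x, ⟨y, by simpa using hxy.symm⟩, rfl⟩
  · rintro r ⟨U, hU, hW, rfl⟩
    have hu : 0 < U.card := hU.card_pos
    have hw : 0 < Uᶜ.card := hW.card_pos
    have hm : (0 : ℝ) < ((min U.card Uᶜ.card : ℕ) : ℝ) := by exact_mod_cast lt_min hu hw
    rw [le_div_iff₀ hm]
    refine le_trans ?_ (SimpleGraph.mul_card_mul_card_compl_le hG hα h U)
    have hn : (Fintype.card V : ℝ) = U.card + Uᶜ.card := by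
      exact_mod_cast (card_add_card_compl U).symm
    rw [div_mul_eq_mul_div, mul_div_assoc]
    refine mul_le_mul_of_nonneg_left ?_ (sub_nonneg.2 hαd)
    rw [hn, Nat.cast_min]
    have hu' : (0 : ℝ) < U.card := by exact_mod_cast hu
    have hw' : (0 : ℝ) < Uᶜ.card := by exact_mod_cast hw
    rw [le_div_iff₀ (by positivity)]
    -- The larger part has at least half of the vertices, hence `min / 2 ≤ |U||Uᶜ| / |V|`.
    rcases le_total (U.card : ℝ) Uᶜ.card with hle | hle
    · rw [min_eq_left hle]; nlinarith
    · rw [min_eq_right hle]; nlinarith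

/-- No edge leaves a connected component, while the mixing bound makes the edge count of a proper
nonempty subset positive. -/
theorem SimpleGraph.connected_of_sq_le [Nonempty V] (hG : G.IsRegularOfDegree d)
    (hα : 0 ≤ α) (hαd : α < d)
    (h : ∀ f : V → ℝ, ∑ x, f x = 0 →
      ∑ x, ((G.adjMatrix ℝ).mulVec f x) ^ 2 ≤ α ^ 2 * ∑ x, f x ^ 2) :
    G.Connected := by
  classical
  refine ⟨fun x y => ?_⟩
  by_contra hxy
  set U : Finset V := univ.filter (G.Reachable x) with hU
  have hxU : x ∈ U := by simp [hU]
  have hyU : y ∈ Uᶜ := by simp [hU, hxy]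
  have he : G.interedges U Uᶜ = ∅ := by
    rw [SimpleGraph.interedges_def, filter_eq_empty_iff]
    rintro ⟨a, b⟩ hab hadj
    simp only [mem_product, mem_compl, hU, mem_filter, mem_univ, true_and] at hab
    exact hab.2 (hab.1.trans hadj.reachable)
  have hle := SimpleGraph.mul_card_mul_card_compl_le hG hα h U
  rw [he, card_empty, Nat.cast_zero] at hle
  have h1 : (0 : ℝ) < U.card := by exact_mod_cast card_pos.2 ⟨x, hxU⟩
  have h2 : (0 : ℝ) < Uᶜ.card := by exact_mod_cast card_pos.2 ⟨y, hyU⟩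
  have h3 : (0 : ℝ) < Fintype.card V := by positivity
  have h4 : 0 < (d : ℝ) - α := sub_pos.2 hαd
  have : 0 < (d - α) * ((U.card : ℝ) * Uᶜ.card / Fintype.card V) := by positivity
  linarith

end GraphGap

/-! ### Descent from unimodular pairs to the Platonic graph -/

section Platonic

variable {R : Type*} [CommRing R]

theorem PlatonicVertex.mk_eq_mk_iff (v w : UnimodularPair R) :
    PlatonicVertex.mk v = PlatonicVertex.mk w ↔ v.1 = w.1 ∨ v.1 = -w.1 :=
  Quotient.eq (r := signSetoid R)

theorem PlatonicVertex.exists_mk (x : PlatonicVertex R) : ∃ v, PlatonicVertex.mk v = x :=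
  Quotient.exists_rep x

theorem pairDet_self (v : R × R) : pairDet v v = 0 := by unfold pairDet; ring

theorem platonicGraph_adj_mk_iff (h1 : (1 : R) ≠ -1) (v : UnimodularPair R)
    (y : PlatonicVertex R) :
    (platonicGraph R).Adj (PlatonicVertex.mk v) y ↔
      ∃ w, pairDet v.1 w.1 = 1 ∧ PlatonicVertex.mk w = y := by
  constructor
  · rintro ⟨-, v', w, hv, rfl, hd⟩
    have hd' : pairDet v.1 w.1 = 1 ∨ pairDet v.1 w.1 = -1 := by
      rcases (PlatonicVertex.mk_eq_mk_iff _ _).1 hv with e | e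
      · rwa [← e]
      · rw [e, pairDet_neg_left, neg_inj, neg_eq_iff_eq_neg] at hd
        exact hd.symm
    rcases hd' with e | e
    · exact ⟨w, e, rfl⟩
    · exact ⟨w.neg, by rw [UnimodularPair.neg, pairDet_neg_right, e, neg_neg],
        (PlatonicVertex.mk_eq_mk_iff _ _).2 (Or.inr rfl)⟩
  · rintro ⟨w, hd, rfl⟩
    refine ⟨fun e => ?_, v, w, rfl, rfl, Or.inl hd⟩
    have h0 : (0 : R) ≠ 1 := fun h0 => h1 (by rw [← h0, neg_zero])
    rcases (PlatonicVertex.mk_eq_mk_iff _ _).1 e with e | e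
    · rw [e, pairDet_self] at hd; exact h0 hd
    · rw [e, pairDet_neg_left, pairDet_self, neg_zero] at hd; exact h0 hd

/-- Of `w` and `-w` at most one has determinant `1` with `v`, because `1 ≠ -1`; each neighbour is
therefore counted once. -/
theorem sum_neighborFinset_platonicGraph [Finite R] (h1 : (1 : R) ≠ -1) (v : UnimodularPair R)
    (F : PlatonicVertex R → ℝ) :
    ∑ y ∈ (platonicGraph R).neighborFinset (PlatonicVertex.mk v), F y
      = ∑ w, detOneKernel R v w * F (PlatonicVertex.mk w) := by
  classical
  have himg : (platonicGraph R).neighborFinset (PlatonicVertex.mk v)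
      = (univ.filter fun w : UnimodularPair R => pairDet v.1 w.1 = 1).image
        PlatonicVertex.mk := by
    ext y
    simp [platonicGraph_adj_mk_iff h1]
  rw [himg, sum_image, sum_filter]
  · refine sum_congr rfl fun w _ => ?_
    simp only [detOneKernel]
    split_ifs <;> simp
  · intro a ha b hb hab
    simp only [coe_filter, mem_univ, true_and, Set.mem_ofPred_eq] at ha hb
    rcases (PlatonicVertex.mk_eq_mk_iff _ _).1 hab with e | e
    · exact Subtype.ext e
    · rw [e, pairDet_neg_right, hb] at ha
      exact absurd ha.symm h1

theorem sum_platonicVertex_mk [Finite R] (h1 : (1 : R) ≠ -1) (F : PlatonicVertex R → ℝ) :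
    ∑ v, F (PlatonicVertex.mk v) = 2 * ∑ x, F x := by
  classical
  rw [← sum_fiberwise univ (PlatonicVertex.mk : UnimodularPair R → _), mul_sum]
  refine sum_congr rfl fun x _ => ?_
  obtain ⟨v, rfl⟩ := x.exists_mk
  have hfib : (univ.filter fun w : UnimodularPair R =>
      PlatonicVertex.mk w = PlatonicVertex.mk v) = {v, v.neg} := by
    ext w
    simp only [mem_filter, mem_univ, true_and, PlatonicVertex.mk_eq_mk_iff, mem_insert,
      mem_singleton]
    exact or_congr Subtype.ext_iff.symm (Subtype.ext_iff (a2 := v.neg)).symm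
  have hne : v ≠ v.neg := fun e => by
    obtain ⟨w, hw⟩ := v.exists_right
    have h2 := pairDet_neg_left v.1 w.1
    have e' : v.1 = -v.1 := congrArg Subtype.val e
    rw [← e', hw] at h2
    exact h1 h2
  have hneg : PlatonicVertex.mk v.neg = PlatonicVertex.mk v :=
    (PlatonicVertex.mk_eq_mk_iff _ _).2 (Or.inr rfl)
  rw [hfib, sum_pair hne, hneg]
  ring

theorem platonicGraph_isRegularOfDegree [Fintype R] (h1 : (1 : R) ≠ -1) :
    (platonicGraph R).IsRegularOfDegree (Fintype.card R) := by
  intro x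
  obtain ⟨v, rfl⟩ := x.exists_mk
  have := sum_neighborFinset_platonicGraph h1 v (fun _ => 1)
  simp only [mul_one, sum_detOneKernel, sum_const, nsmul_eq_mul] at this
  exact_mod_cast this

theorem platonicGraph_sq_le [Finite R] (h1 : (1 : R) ≠ -1) {d s : ℝ}
    (h : BiregularGap (detOneKernel R) d s) (F : PlatonicVertex R → ℝ) (hF : ∑ x, F x = 0) :
    ∑ x, (((platonicGraph R).adjMatrix ℝ).mulVec F x) ^ 2 ≤ s * ∑ x, F x ^ 2 := by
  have hs := h.sq_le (fun v => F (PlatonicVertex.mk v)) (by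
    rw [sum_platonicVertex_mk h1, hF, mul_zero])
  simp only [← sum_neighborFinset_platonicGraph h1,
    ← SimpleGraph.adjMatrix_mulVec_apply] at hs
  rw [sum_platonicVertex_mk h1 (fun x => (((platonicGraph R).adjMatrix ℝ).mulVec F x) ^ 2),
    sum_platonicVertex_mk h1 (fun x => F x ^ 2)] at hs
  linarith

end Platonic

theorem mainTheorem9 (N : ℕ) [NeZero N] (hN : 1 < N) (hodd : Odd N)
    (p : ℕ) (hp : IsLeast {q : ℕ | q.Prime ∧ q ∣ N} p) :
    (platonicGraph (ZMod N)).Connected ∧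
    (platonicGraph (ZMod N)).IsRegularOfDegree N ∧
    (∃ α : ℝ, IsGreatest (nontrivialEigenvalues (platonicGraph (ZMod N)) N) α ∧
      α ≤ (N : ℝ) / √(p : ℝ)) ∧
    (N : ℝ) / 2 * (1 - 1 / √(p : ℝ)) ≤ isoperimetricConstant (platonicGraph (ZMod N)) := by
  have : Fact (1 < N) := ⟨hN⟩
  -- Oddness enters only here, to give `2 < N` and so `1 ≠ -1`.
  have : Fact (2 < N) := ⟨by obtain ⟨k, rfl⟩ := hodd; omega⟩
  have h1 : (1 : ZMod N) ≠ -1 := ZMod.neg_one_ne_one.symm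
  have hN0 : (0 : ℝ) < N := by positivity
  have hp1 : (1 : ℝ) < p := by exact_mod_cast hp.1.1.one_lt
  have hp0 : (0 : ℝ) < p := by linarith
  have hs1 : 1 < √(p : ℝ) := by rwa [Real.lt_sqrt zero_le_one, one_pow]
  have hα : 0 ≤ (N : ℝ) / √(p : ℝ) := by positivity
  have hαN : (N : ℝ) / √(p : ℝ) < N := div_lt_self hN0 hs1
  have hreg : (platonicGraph (ZMod N)).IsRegularOfDegree N := by
    simpa only [ZMod.card] using platonicGraph_isRegularOfDegree h1
  have hgap := platonicGraph_sq_le h1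
    (biregularGap_zmod hp0 N fun q hq hd => by exact_mod_cast hp.2 ⟨hq, hd⟩)
  have hsq : (N : ℝ) ^ 2 / p = ((N : ℝ) / √(p : ℝ)) ^ 2 := by
    rw [div_pow, Real.sq_sqrt hp0.le]
  rw [hsq] at hgap
  let x : PlatonicVertex (ZMod N) := PlatonicVertex.mk ⟨(1, 0), (0, 1), by simp [pairDet]⟩
  have : Nonempty (PlatonicVertex (ZMod N)) := ⟨x⟩
  have : Nontrivial (PlatonicVertex (ZMod N)) := by
    have hx : 0 < (platonicGraph (ZMod N)).degree x := by rw [hreg x]; omega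
    obtain ⟨y, hy⟩ := (SimpleGraph.degree_pos_iff_exists_adj _ _).1 hx
    exact ⟨x, y, hy.ne⟩
  refine ⟨SimpleGraph.connected_of_sq_le hreg hα hαN hgap, hreg, ?_, ?_⟩
  · obtain ⟨μ, hμ⟩ := exists_isGreatest_nontrivialEigenvalues
      (G := platonicGraph (ZMod N)) (d := N) (NeZero.ne N)
    exact ⟨μ, hμ, (le_abs_self μ).trans (abs_le_of_mem_nontrivialEigenvalues hreg hα hgap hμ.1)⟩
  · refine le_of_eq_of_le ?_ (le_isoperimetricConstant hreg hα hαN.le hgap)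
    ring
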